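/- Let $\alpha,\beta\in\mathbb{R}$ with $\alpha>\frac12$ and $\alpha>\beta>-\frac12$, put $\rho=\alpha+\beta+1$, and let $d\mu(t)=\Delta(t)\,dt$ on $(0,\infty)$, where $\Delta(t)=(2\sinh t)^{2\alpha+1}(2\cosh t)^{2\beta+1}$. For $s,t,u>0$ with $|s-t|<u<s+t$ set $$K(s,t,u)=\frac{2^{-2\rho}\,\Gamma(\alpha+1)}{\sqrt{\pi}\,\Gamma(\alpha+\frac12)}\,\frac{(\cosh s\cosh t\cosh u)^{\alpha-\beta-1}}{(\sinh s\sinh t\sinh u)^{2\alpha}}\,(1-B^2)^{\alpha-\frac12}\;{}_2F_1\bigl(\alpha+\beta,\alpha-\beta;\alpha+\tfrac12;\tfrac12(1-B)\bigr),$$ $$B=B(s,t,u)=\frac{\cosh^2s+\cosh^2t+\cosh^2u-1}{2\cosh s\cosh t\cosh u},$$ and $K(s,t,u)=0$ otherwise; this is the kernel for which $\varphi(s)\varphi(t)=\int_0^\infty\varphi(u)K(s,t,u)\,d\mu(u)$ for every Jacobi function $\varphi=\varphi^{(\alpha,\beta)}_\lambda$. The Jacobi convolution of functions $f,g$ on $(0,\infty)$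 is $$(f\star g)(x)=\int_0^\infty f(y)\Bigl(\int_0^\infty g(z)K(x,y,z)\,d\mu(z)\Bigr)d\mu(y).$$ Let $\delta>0$ and let $k:\mathbb{R}\to\mathbb{C}$ be an even function whose restriction to $(0,\infty)$ belongs to $L^r(d\mu)$ for all $r\in(1,1+\delta)$. Then, for every $s\in(1,\infty)$, $f\mapsto k\star f$ is a bounded linear operator on $L^s(d\mu)$: for every $f\in L^s(d\mu)$ the double integral defining $(k\star f)(x)$ converges absolutely for $\mu$-almost every $x$, and there is a bounded linear operator $T$ on $L^s(d\mu)$ such that $Tf=k\star f$ $\mu$-almost everywhere for every $f\in L^s(d\mu)$. -/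

import Mathlib

open MeasureTheory Set
open scoped ENNReal

/-- The Jacobi weight `Δ(t) = (2 sinh t)^(2α+1) (2 cosh t)^(2β+1)`, for `t > 0`. -/
noncomputable def jacobiWeight (α β t : ℝ) : ℝ :=
  (2 * Real.sinh t) ^ (2 * α + 1) * (2 * Real.cosh t) ^ (2 * β + 1)

/-- The weighted measure `dμ(t) = Δ(t) dt` on `(0, ∞)`, regarded as a measure on `ℝ` which is
carried by `(0, ∞)`. -/
noncomputable def jacobiMeasure (α β : ℝ) : Measure ℝ :=
  (volume.restrict (Ioi 0)).withDensity fun t => ENNReal.ofReal (jacobiWeight α β t)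

/-- `B(s,t,u) = (cosh² s + cosh² t + cosh² u - 1) / (2 cosh s cosh t cosh u)`. It takes its values
in `(0, 1)` when `|s - t| < u < s + t`. -/
noncomputable def jacobiB (s t u : ℝ) : ℝ :=
  (Real.cosh s ^ 2 + Real.cosh t ^ 2 + Real.cosh u ^ 2 - 1) /
    (2 * Real.cosh s * Real.cosh t * Real.cosh u)

open Classical in
/-- The kernel `K(s,t,u)` of the generalized translation. It is supported in
`|s - t| < u < s + t` (which forces `s, t, u > 0`), and the hypergeometric series is evaluated
at `(1 - B) / 2`, a point of `(0, 1/2)`. The constant, in which `ρ = α + β + 1`, is the one for which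
`φ(s) φ(t) = ∫ φ(u) K(s,t,u) dμ(u)` for all Jacobi functions `φ` of parameters `(α, β)`;
in particular `K(s,t,·) dμ` is a probability measure for `s, t > 0`. -/
noncomputable def jacobiKernel (α β s t u : ℝ) : ℝ :=
  if |s - t| < u ∧ u < s + t then
    (2 : ℝ) ^ (-2 * (α + β + 1)) * Real.Gamma (α + 1) /
        (Real.sqrt Real.pi * Real.Gamma (α + 1 / 2)) *
      ((Real.cosh s * Real.cosh t * Real.cosh u) ^ (α - β - 1) /
        (Real.sinh s * Real.sinh t * Real.sinh u) ^ (2 * α)) *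
      (1 - jacobiB s t u ^ 2) ^ (α - 1 / 2) *
      ordinaryHypergeometric (α + β) (α - β) (α + 1 / 2) ((1 - jacobiB s t u) / 2)
  else 0

/-- The generalized translation `(τ_x g)(y) = ∫ g(z) K(x,y,z) dμ(z)`. -/
noncomputable def jacobiTranslation (α β : ℝ) (x : ℝ) (g : ℝ → ℂ) (y : ℝ) : ℂ :=
  ∫ z, g z * (jacobiKernel α β x y z : ℂ) ∂(jacobiMeasure α β)

/-- The generalized convolution `(f ⋆ g)(x) = ∫ f(y) (τ_x g)(y) dμ(y)`. -/
noncomputable def jacobiConvolution (α β : ℝ) (f g : ℝ → ℂ) (x : ℝ) : ℂ :=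
  ∫ y, f y * jacobiTranslation α β x g y ∂(jacobiMeasure α β)

/-- Absolute convergence of the double integral
`∫∫ f(y) g(z) K(x,y,z) dμ(z) dμ(y)` that defines `(f ⋆ g)(x)`. -/
def JacobiConvolutionExistsAt (α β : ℝ) (f g : ℝ → ℂ) (x : ℝ) : Prop :=
  Integrable (fun p : ℝ × ℝ => f p.1 * g p.2 * (jacobiKernel α β x p.1 p.2 : ℂ))
    ((jacobiMeasure α β).prod (jacobiMeasure α β))

theorem continuousOn_ordinaryHypergeometric {a b c : ℝ} (ha : 0 < a) (hb : 0 < b) (hc : 0 < c) :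
    ContinuousOn (fun x : ℝ => ordinaryHypergeometric a b c x) (Metric.ball 0 1) := by
  have hr : (ordinaryHypergeometricSeries ℝ a b c).radius = 1 := by
    apply ordinaryHypergeometricSeries_radius_eq_one
    intro n
    have : (0 : ℝ) ≤ n := n.cast_nonneg
    refine ⟨?_, ?_, ?_⟩ <;> intro h <;> linarith
  have h := ((ordinaryHypergeometricSeries ℝ a b c).hasFPowerSeriesOnBall
    (by rw [hr]; exact one_pos)).continuousOn
  rw [hr, ← ENNReal.ofReal_one, Metric.eball_ofReal] at h
  exact h

theorem exists_abs_ordinaryHypergeometric_le {a b c : ℝ} (ha : 0 < a) (hb : 0 < b) (hc : 0 < c) :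
    ∃ M : ℝ, 0 ≤ M ∧ ∀ x ∈ Icc (0 : ℝ) (1 / 2), |ordinaryHypergeometric a b c x| ≤ M := by
  have hsub : Icc (0 : ℝ) (1 / 2) ⊆ Metric.ball 0 1 := by
    intro x hx
    rw [Metric.mem_ball, dist_zero_right, Real.norm_eq_abs, abs_lt]
    constructor <;> linarith [hx.1, hx.2]
  obtain ⟨M, hM⟩ := isCompact_Icc.exists_bound_of_continuousOn
    ((continuousOn_ordinaryHypergeometric ha hb hc).mono hsub)
  exact ⟨max M 0, le_max_right _ _, fun x hx => (hM x hx).trans (le_max_left _ _)⟩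

/-- The quantity `1 - B` is controlled by Heron's formula for hyperbolic triangles. -/
theorem one_sub_jacobiB (s t u : ℝ) :
    1 - jacobiB s t u = ((Real.sinh s * Real.sinh t) ^ 2 -
      (Real.cosh u - Real.cosh s * Real.cosh t) ^ 2) /
        (2 * Real.cosh s * Real.cosh t * Real.cosh u) := by
  have hs := Real.cosh_pos s
  have ht := Real.cosh_pos t
  have hu := Real.cosh_pos u
  rw [jacobiB, eq_div_iff (by positivity), sub_mul, div_mul_cancel₀ _ (by positivity),
    mul_pow, Real.sinh_sq, Real.sinh_sq]
  ring

theorem cosh_mem_Ioo_of_triangle {s t u : ℝ} (h₁ : |s - t| < u) (h₂ : u < s + t) :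
    Real.cosh u ∈ Ioo (Real.cosh s * Real.cosh t - Real.sinh s * Real.sinh t)
      (Real.cosh s * Real.cosh t + Real.sinh s * Real.sinh t) := by
  have hu : 0 < u := (abs_nonneg _).trans_lt h₁
  rw [← Real.cosh_sub, ← Real.cosh_add]
  constructor
  · rw [Real.cosh_lt_cosh, abs_of_pos hu]
    exact h₁
  · rw [Real.cosh_lt_cosh, abs_of_pos hu]
    exact h₂.trans_le (le_abs_self _)

theorem jacobiB_mem_Ioo {s t u : ℝ} (h₁ : |s - t| < u) (h₂ : u < s + t) :
    jacobiB s t u ∈ Ioo (0 : ℝ) 1 := by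
  have hs := Real.cosh_pos s
  have ht := Real.cosh_pos t
  have hu := Real.cosh_pos u
  constructor
  · have := Real.one_le_cosh s
    unfold jacobiB
    have : 0 < Real.cosh s ^ 2 + Real.cosh t ^ 2 + Real.cosh u ^ 2 - 1 := by nlinarith
    positivity
  · have h := cosh_mem_Ioo_of_triangle h₁ h₂
    have : 0 < 1 - jacobiB s t u := by
      rw [one_sub_jacobiB]
      apply div_pos _ (by positivity)
      nlinarith [h.1, h.2]
    linarith

theorem one_sub_jacobiB_sq_le {s t u : ℝ} (h₁ : |s - t| < u) (h₂ : u < s + t) :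
    1 - jacobiB s t u ^ 2 ≤ (Real.sinh s * Real.sinh t) ^ 2 /
      (Real.cosh s * Real.cosh t * Real.cosh u) := by
  have hs := Real.cosh_pos s
  have ht := Real.cosh_pos t
  have hu := Real.cosh_pos u
  have hB := jacobiB_mem_Ioo h₁ h₂
  have h : 1 - jacobiB s t u ^ 2 ≤ 2 * (1 - jacobiB s t u) := by nlinarith [hB.1, hB.2]
  refine h.trans ?_
  rw [one_sub_jacobiB, le_div_iff₀ (by positivity)]
  have : 2 * (((Real.sinh s * Real.sinh t) ^ 2 -
      (Real.cosh u - Real.cosh s * Real.cosh t) ^ 2) /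
        (2 * Real.cosh s * Real.cosh t * Real.cosh u)) *
      (Real.cosh s * Real.cosh t * Real.cosh u) = (Real.sinh s * Real.sinh t) ^ 2 -
      (Real.cosh u - Real.cosh s * Real.cosh t) ^ 2 := by
    field_simp
  rw [this]
  nlinarith [sq_nonneg (Real.cosh u - Real.cosh s * Real.cosh t)]

theorem jacobiB_swap_right (s t u : ℝ) : jacobiB s u t = jacobiB s t u := by
  unfold jacobiB
  congr 1 <;> ring

theorem jacobiB_swap_left (s t u : ℝ) : jacobiB t s u = jacobiB s t u := by
  unfold jacobiB
  congr 1 <;> ring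

theorem jacobiKernel_swap_right (α β s t u : ℝ) :
    jacobiKernel α β s u t = jacobiKernel α β s t u := by
  have h : (|s - u| < t ∧ t < s + u) ↔ (|s - t| < u ∧ u < s + t) := by
    rw [abs_lt, abs_lt]
    constructor <;> rintro ⟨⟨_, _⟩, _⟩ <;> refine ⟨⟨?_, ?_⟩, ?_⟩ <;> linarith
  unfold jacobiKernel
  rw [jacobiB_swap_right, mul_right_comm (Real.cosh s), mul_right_comm (Real.sinh s)]
  simp only [h]

theorem jacobiKernel_swap_left (α β s t u : ℝ) :
    jacobiKernel α β t s u = jacobiKernel α β s t u := by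
  unfold jacobiKernel
  rw [jacobiB_swap_left, mul_comm (Real.cosh t), mul_comm (Real.sinh t), abs_sub_comm, add_comm t]

theorem measurable_jacobiB : Measurable fun p : ℝ × ℝ × ℝ => jacobiB p.1 p.2.1 p.2.2 := by
  unfold jacobiB
  fun_prop

theorem measurable_jacobiKernel {α β : ℝ} (hα : 0 < α + 1 / 2) (hαβ : 0 < α - β)
    (hβ : 0 < α + β) :
    Measurable fun p : ℝ × ℝ × ℝ => jacobiKernel α β p.1 p.2.1 p.2.2 := by
  classical
  have hF : Measurable ((Metric.ball (0 : ℝ) 1).piecewise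
      (fun x : ℝ => ordinaryHypergeometric (α + β) (α - β) (α + 1 / 2) x) (fun _ => 0)) :=
    (continuousOn_ordinaryHypergeometric hβ hαβ hα).measurable_piecewise continuousOn_const
      Metric.isOpen_ball.measurableSet
  have hS : MeasurableSet {p : ℝ × ℝ × ℝ | |p.1 - p.2.1| < p.2.2 ∧ p.2.2 < p.1 + p.2.1} :=
    (measurableSet_lt (f := fun p : ℝ × ℝ × ℝ => |p.1 - p.2.1|) (g := fun p => p.2.2)
      (by fun_prop) (by fun_prop)).inter
    (measurableSet_lt (f := fun p : ℝ × ℝ × ℝ => p.2.2) (g := fun p => p.1 + p.2.1)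
      (by fun_prop) (by fun_prop))
  have hB := measurable_jacobiB
  have hm : Measurable fun p : ℝ × ℝ × ℝ =>
      if |p.1 - p.2.1| < p.2.2 ∧ p.2.2 < p.1 + p.2.1 then
    (2 : ℝ) ^ (-2 * (α + β + 1)) * Real.Gamma (α + 1) /
        (Real.sqrt Real.pi * Real.Gamma (α + 1 / 2)) *
      ((Real.cosh p.1 * Real.cosh p.2.1 * Real.cosh p.2.2) ^ (α - β - 1) /
        (Real.sinh p.1 * Real.sinh p.2.1 * Real.sinh p.2.2) ^ (2 * α)) *
      (1 - jacobiB p.1 p.2.1 p.2.2 ^ 2) ^ (α - 1 / 2) *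
      ((Metric.ball (0 : ℝ) 1).piecewise
        (fun x : ℝ => ordinaryHypergeometric (α + β) (α - β) (α + 1 / 2) x) (fun _ => 0))
          ((1 - jacobiB p.1 p.2.1 p.2.2) / 2)
    else 0 := by
    refine Measurable.ite hS ?_ measurable_const
    exact (by fun_prop : Measurable fun p : ℝ × ℝ × ℝ =>
      (2 : ℝ) ^ (-2 * (α + β + 1)) * Real.Gamma (α + 1) /
        (Real.sqrt Real.pi * Real.Gamma (α + 1 / 2)) *
      ((Real.cosh p.1 * Real.cosh p.2.1 * Real.cosh p.2.2) ^ (α - β - 1) /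
        (Real.sinh p.1 * Real.sinh p.2.1 * Real.sinh p.2.2) ^ (2 * α)) *
      (1 - jacobiB p.1 p.2.1 p.2.2 ^ 2) ^ (α - 1 / 2)).mul
        (hF.comp ((measurable_const.sub hB).div_const 2))
  convert hm using 2 with p
  unfold jacobiKernel
  split_ifs with h
  · have hB := jacobiB_mem_Ioo h.1 h.2
    rw [piecewise_eq_of_mem]
    rw [Metric.mem_ball, dist_zero_right, Real.norm_eq_abs, abs_lt]
    constructor <;> linarith [hB.1, hB.2]
  · rfl

theorem measurable_jacobiWeight (α β : ℝ) : Measurable (jacobiWeight α β) := by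
  unfold jacobiWeight
  fun_prop

/-- On its support the kernel, multiplied by the weight and a power of `cosh`, is dominated
by a multiple of `sinh u / (sinh s sinh t)`. -/
theorem exists_jacobiKernel_mul_weight_le {α β : ℝ} (hα : 1 / 2 < α) (hαβ : β < α)
    (hβ : -1 / 2 < β) :
    ∃ C : ℝ, 0 ≤ C ∧ ∀ c : ℝ, 0 ≤ c → c ≤ β + 1 / 2 → ∀ s t u : ℝ, 0 < s → 0 < t →
      |s - t| < u → u < s + t →
      |jacobiKernel α β s t u| * (Real.cosh u ^ (-c) * jacobiWeight α β u) ≤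
        C * (Real.cosh s ^ (-c) * Real.cosh t ^ (-c)) *
          (Real.sinh u / (Real.sinh s * Real.sinh t)) := by
  obtain ⟨M, hM0, hM⟩ := exists_abs_ordinaryHypergeometric_le (a := α + β) (b := α - β)
    (c := α + 1 / 2) (by linarith) (by linarith) (by linarith)
  set D : ℝ := (2 : ℝ) ^ (-2 * (α + β + 1)) * Real.Gamma (α + 1) /
        (Real.sqrt Real.pi * Real.Gamma (α + 1 / 2)) with hD
  clear_value D
  refine ⟨|D| * M * ((2 : ℝ) ^ (2 * α + 1) * (2 : ℝ) ^ (2 * β + 1)) * (2 : ℝ) ^ (β + 1 / 2),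
    by positivity, ?_⟩
  intro c hc0 hc s t u hs ht h₁ h₂
  have hu : 0 < u := (abs_nonneg _).trans_lt h₁
  have hB := jacobiB_mem_Ioo h₁ h₂
  have hB2 : 0 ≤ 1 - jacobiB s t u ^ 2 := by nlinarith [hB.1, hB.2]
  have hF := hM ((1 - jacobiB s t u) / 2) ⟨by linarith [hB.2], by linarith [hB.1]⟩
  have hle := one_sub_jacobiB_sq_le h₁ h₂
  have hw := (cosh_mem_Ioo_of_triangle h₁ h₂).2
  have hσab : Real.sinh s * Real.sinh t ≤ Real.cosh s * Real.cosh t :=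
    mul_le_mul (Real.sinh_lt_cosh s).le (Real.sinh_lt_cosh t).le
      (Real.sinh_pos_iff.2 ht).le (Real.cosh_pos s).le
  rw [jacobiKernel, if_pos ⟨h₁, h₂⟩, ← hD, jacobiWeight]
  have ha := Real.cosh_pos s
  have hb := Real.cosh_pos t
  have hw0 := Real.cosh_pos u
  have hx := Real.sinh_pos_iff.2 hs
  have hy := Real.sinh_pos_iff.2 ht
  have hz := Real.sinh_pos_iff.2 hu
  generalize jacobiB s t u = B at *
  generalize ordinaryHypergeometric (α + β) (α - β) (α + 1 / 2) ((1 - B) / 2) = F at *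
  generalize Real.cosh s = a at *
  generalize Real.cosh t = b at *
  generalize Real.cosh u = w at *
  generalize Real.sinh s = x at *
  generalize Real.sinh t = y at *
  generalize Real.sinh u = z at *
  have e1 : (1 - B ^ 2) ^ (α - 1 / 2) ≤ ((x * y) ^ 2 / (a * b * w)) ^ (α - 1 / 2) :=
    Real.rpow_le_rpow hB2 hle (by linarith)
  have e2 : w ^ (β + 1 / 2 - c) ≤ (2 * (a * b)) ^ (β + 1 / 2 - c) :=
    Real.rpow_le_rpow hw0.le (by linarith) (by linarith)
  have e3 : (2 : ℝ) ^ (β + 1 / 2 - c) ≤ 2 ^ (β + 1 / 2) :=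
    Real.rpow_le_rpow_of_exponent_le (by norm_num) (by linarith)
  have hk : (a * b * w) ^ (α - β - 1) / (x * y * z) ^ (2 * α) *
      ((x * y) ^ 2 / (a * b * w)) ^ (α - 1 / 2) * (w ^ (-c) * (z ^ (2 * α + 1) *
        w ^ (2 * β + 1))) = (a * b) ^ (-(β + 1 / 2)) * w ^ (β + 1 / 2 - c) * (z / (x * y)) := by
    rw [Real.div_rpow (by positivity) (by positivity), ← Real.rpow_natCast,
      ← Real.rpow_mul (by positivity), Real.mul_rpow (by positivity) hz.le,
      Real.mul_rpow (by positivity) hw0.le, Real.mul_rpow (by positivity) hw0.le]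
    have h1 : (a * b) ^ (α - β - 1) = (a * b) ^ (-(β + 1 / 2)) * (a * b) ^ (α - 1 / 2) := by
      rw [← Real.rpow_add (by positivity)]; congr 1; ring
    have h2 : (x * y) ^ (2 * α) = (x * y) ^ ((2 : ℕ) * (α - 1 / 2)) * (x * y) := by
      rw [← Real.rpow_add_one (by positivity)]; congr 1; push_cast; ring
    have h3 : z ^ (2 * α + 1) = z ^ (2 * α) * z := Real.rpow_add_one hz.ne' _
    have h4 : w ^ (β + 1 / 2 - c) = w ^ (α - β - 1) / w ^ (α - 1 / 2) * w ^ (-c) *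
        w ^ (2 * β + 1) := by
      rw [← Real.rpow_sub hw0, ← Real.rpow_add hw0, ← Real.rpow_add hw0]; congr 1; ring
    rw [h1, h2, h3, h4]
    field_simp
  calc |D * ((a * b * w) ^ (α - β - 1) / (x * y * z) ^ (2 * α)) *
        (1 - B ^ 2) ^ (α - 1 / 2) * F| *
        (w ^ (-c) * ((2 * z) ^ (2 * α + 1) * (2 * w) ^ (2 * β + 1)))
      = |D| * |F| * ((2 : ℝ) ^ (2 * α + 1) * (2 : ℝ) ^ (2 * β + 1)) *
        ((a * b * w) ^ (α - β - 1) / (x * y * z) ^ (2 * α) * (1 - B ^ 2) ^ (α - 1 / 2) *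
          (w ^ (-c) * (z ^ (2 * α + 1) * w ^ (2 * β + 1)))) := by
        rw [abs_mul, abs_mul, abs_mul, abs_of_nonneg (a := _ / _) (by positivity),
          abs_of_nonneg (a := _ ^ (α - 1 / 2)) (by positivity),
          Real.mul_rpow zero_le_two hz.le, Real.mul_rpow zero_le_two hw0.le]
        ring
    _ ≤ |D| * M * ((2 : ℝ) ^ (2 * α + 1) * (2 : ℝ) ^ (2 * β + 1)) *
        ((a * b * w) ^ (α - β - 1) / (x * y * z) ^ (2 * α) *
          ((x * y) ^ 2 / (a * b * w)) ^ (α - 1 / 2) *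
          (w ^ (-c) * (z ^ (2 * α + 1) * w ^ (2 * β + 1)))) := by
        gcongr
    _ = |D| * M * ((2 : ℝ) ^ (2 * α + 1) * (2 : ℝ) ^ (2 * β + 1)) *
        ((a * b) ^ (-(β + 1 / 2)) * w ^ (β + 1 / 2 - c) * (z / (x * y))) := by rw [hk]
    _ ≤ |D| * M * ((2 : ℝ) ^ (2 * α + 1) * (2 : ℝ) ^ (2 * β + 1)) *
        ((a * b) ^ (-(β + 1 / 2)) * (2 ^ (β + 1 / 2) * (a * b) ^ (β + 1 / 2 - c)) *
          (z / (x * y))) := by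
        gcongr
        refine e2.trans ?_
        rw [Real.mul_rpow zero_le_two (by positivity)]
        gcongr
    _ = _ := by
        have h5 : a ^ (-c) * b ^ (-c) =
            (a * b) ^ (-(β + 1 / 2)) * (a * b) ^ (β + 1 / 2 - c) := by
          rw [← Real.mul_rpow ha.le hb.le, ← Real.rpow_add (by positivity)]; congr 1; ring
        rw [h5]
        ring

instance (α β : ℝ) : SigmaFinite (jacobiMeasure α β) := by
  unfold jacobiMeasure
  infer_instance

theorem ae_jacobiMeasure_pos (α β : ℝ) : ∀ᵐ x ∂(jacobiMeasure α β), 0 < x :=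
  (withDensity_absolutelyContinuous _ _).ae_le (ae_restrict_mem measurableSet_Ioi)

theorem lintegral_jacobiMeasure (α β : ℝ) {g : ℝ → ℝ≥0∞} (hg : Measurable g) :
    ∫⁻ z, g z ∂(jacobiMeasure α β) =
      ∫⁻ z in Ioi 0, g z * ENNReal.ofReal (jacobiWeight α β z) := by
  rw [jacobiMeasure, lintegral_withDensity_eq_lintegral_mul _
    (measurable_jacobiWeight α β).ennreal_ofReal hg]
  simp only [Pi.mul_apply, mul_comm]

theorem setLIntegral_ofReal_sinh {a b : ℝ} (ha : 0 ≤ a) (hab : a ≤ b) :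
    ∫⁻ z in Ioc a b, ENNReal.ofReal (Real.sinh z) =
      ENNReal.ofReal (Real.cosh b - Real.cosh a) := by
  have h : ∫ z in a..b, Real.sinh z = Real.cosh b - Real.cosh a :=
    intervalIntegral.integral_eq_sub_of_hasDerivAt (fun z _ => Real.hasDerivAt_cosh z)
      (Real.continuous_sinh.intervalIntegrable _ _)
  rw [← h, intervalIntegral.integral_of_le hab, ofReal_integral_eq_lintegral_ofReal]
  · exact (Real.continuous_sinh.intervalIntegrable a b).1
  · filter_upwards [ae_restrict_mem measurableSet_Ioc] with z hz
    exact Real.sinh_nonneg_iff.2 (ha.trans hz.1.le)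

/-- The generalized translates of a small negative power of `cosh` are dominated by the product
of that power in the two variables. -/
theorem exists_lintegral_jacobiKernel_le {α β : ℝ} (hα : 1 / 2 < α) (hαβ : β < α)
    (hβ : -1 / 2 < β) :
    ∃ C : ℝ≥0∞, C ≠ ∞ ∧ ∀ c : ℝ, 0 ≤ c → c ≤ β + 1 / 2 → ∀ x y : ℝ, 0 < x → 0 < y →
      ∫⁻ z, ‖jacobiKernel α β x y z‖ₑ * ENNReal.ofReal (Real.cosh z ^ (-c))
        ∂(jacobiMeasure α β) ≤
      C * (ENNReal.ofReal (Real.cosh x ^ (-c)) * ENNReal.ofReal (Real.cosh y ^ (-c))) := by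
  obtain ⟨C, hC0, hC⟩ := exists_jacobiKernel_mul_weight_le hα hαβ hβ
  refine ⟨ENNReal.ofReal (2 * C), ENNReal.ofReal_ne_top, fun c hc0 hc x y hx hy => ?_⟩
  have hK : Measurable fun z => jacobiKernel α β x y z :=
    (measurable_jacobiKernel (by linarith) (by linarith) (by linarith)).comp
      (g := fun p : ℝ × ℝ × ℝ => jacobiKernel α β p.1 p.2.1 p.2.2)
      (f := fun z : ℝ => (x, y, z)) (by fun_prop)
  rw [lintegral_jacobiMeasure _ _ (by fun_prop)]
  have hsx := Real.sinh_pos_iff.2 hx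
  have hsy := Real.sinh_pos_iff.2 hy
  set D : ℝ := C * (Real.cosh x ^ (-c) * Real.cosh y ^ (-c)) / (Real.sinh x * Real.sinh y) with hD
  have hcx := Real.cosh_pos x
  have hcy := Real.cosh_pos y
  have hD0 : 0 ≤ D := by positivity
  have hle : |x - y| ≤ x + y := abs_le.2 ⟨by linarith, by linarith⟩
  calc ∫⁻ z in Ioi 0, ‖jacobiKernel α β x y z‖ₑ * ENNReal.ofReal (Real.cosh z ^ (-c)) *
        ENNReal.ofReal (jacobiWeight α β z)
      ≤ ∫⁻ z, (Ioc |x - y| (x + y)).indicator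
          (fun z => ENNReal.ofReal D * ENNReal.ofReal (Real.sinh z)) z := by
        refine (setLIntegral_le_lintegral _ _).trans (lintegral_mono fun z => ?_)
        by_cases h : |x - y| < z ∧ z < x + y
        · rw [indicator_of_mem (show z ∈ Ioc |x - y| (x + y) from ⟨h.1, h.2.le⟩), Real.enorm_eq_ofReal_abs,
            ← ENNReal.ofReal_mul hD0, mul_assoc, ← ENNReal.ofReal_mul (by positivity),
            ← ENNReal.ofReal_mul (by positivity)]
          apply ENNReal.ofReal_le_ofReal
          refine (hC c hc0 hc x y z hx hy h.1 h.2).trans_eq ?_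
          rw [hD]
          ring
        · simp [jacobiKernel, h]
    _ = ENNReal.ofReal D * ENNReal.ofReal (Real.cosh (x + y) - Real.cosh |x - y|) := by
        rw [lintegral_indicator measurableSet_Ioc, lintegral_const_mul _ (by fun_prop),
          setLIntegral_ofReal_sinh (abs_nonneg _) hle]
    _ ≤ _ := by
        rw [Real.cosh_abs, Real.cosh_add, Real.cosh_sub, ← ENNReal.ofReal_mul hD0,
          ← ENNReal.ofReal_mul (by positivity), ← ENNReal.ofReal_mul (by positivity)]
        apply ENNReal.ofReal_le_ofReal
        rw [hD]
        apply le_of_eq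
        field_simp
        ring

theorem jacobiWeight_le {α β t : ℝ} (hα : 0 ≤ 2 * α + 1) (ht : 0 ≤ t) :
    jacobiWeight α β t ≤
      (2 : ℝ) ^ (2 * (α + β + 1)) * Real.cosh t ^ (2 * (α + β + 1)) := by
  have h := Real.cosh_pos t
  have hs := Real.sinh_nonneg_iff.2 ht
  calc jacobiWeight α β t
      ≤ (2 * Real.cosh t) ^ (2 * α + 1) * (2 * Real.cosh t) ^ (2 * β + 1) := by
        unfold jacobiWeight
        gcongr
        exact (Real.sinh_lt_cosh t).le
    _ = _ := by
        rw [← Real.rpow_add (by positivity), ← Real.mul_rpow zero_le_two h.le]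
        congr 1
        ring

theorem lintegral_cosh_rpow_neg_lt_top {α β c : ℝ} (hα : 0 ≤ 2 * α + 1)
    (hc : 2 * (α + β + 1) < c) :
    ∫⁻ t, ENNReal.ofReal (Real.cosh t ^ (-c)) ∂(jacobiMeasure α β) < ∞ := by
  rw [lintegral_jacobiMeasure _ _ (by fun_prop)]
  set ρ : ℝ := 2 * (α + β + 1) with hρ
  have he : 0 < c - ρ := by linarith
  have hint := ((exp_neg_integrableOn_Ioi 0 he).const_mul
    ((2 : ℝ) ^ ρ * (2 : ℝ) ^ (c - ρ))).lintegral_lt_top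
  refine lt_of_le_of_lt (setLIntegral_mono (by fun_prop) fun t ht => ?_) hint
  have h := Real.cosh_pos t
  rw [← ENNReal.ofReal_mul (by positivity)]
  apply ENNReal.ofReal_le_ofReal
  have h1 : Real.cosh t ^ (-(c - ρ)) ≤ (Real.exp t / 2) ^ (-(c - ρ)) := by
    apply Real.rpow_le_rpow_of_nonpos (by positivity) _ (by linarith)
    rw [Real.cosh_eq]
    linarith [Real.exp_pos (-t)]
  calc Real.cosh t ^ (-c) * jacobiWeight α β t
      ≤ Real.cosh t ^ (-c) * ((2 : ℝ) ^ ρ * Real.cosh t ^ ρ) := by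
        gcongr
        exact jacobiWeight_le hα (le_of_lt ht)
    _ = (2 : ℝ) ^ ρ * Real.cosh t ^ (-(c - ρ)) := by
        rw [mul_left_comm, ← Real.rpow_add h]
        congr 2
        ring
    _ ≤ (2 : ℝ) ^ ρ * (Real.exp t / 2) ^ (-(c - ρ)) := by gcongr
    _ = _ := by
        rw [Real.div_rpow (Real.exp_pos t).le zero_le_two, ← Real.exp_mul,
          Real.rpow_neg zero_le_two, div_inv_eq_mul, mul_neg, neg_mul, mul_comm t]
        ring

theorem lintegral_enorm_mul_cosh_rpow_neg_lt_top {α β δ c : ℝ} (hα : 0 ≤ 2 * α + 1) (hδ : 0 < δ)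
    {k : ℝ → ℂ}
    (hk : ∀ r : ℝ, 1 < r → r < 1 + δ → MemLp k (ENNReal.ofReal r) (jacobiMeasure α β))
    (hc : 0 < c) :
    ∫⁻ t, ‖k t‖ₑ * ENNReal.ofReal (Real.cosh t ^ (-c)) ∂(jacobiMeasure α β) < ∞ := by
  obtain ⟨q, hq⟩ := exists_gt (max (1 + 1 / δ) (2 * (α + β + 1) / c))
  obtain ⟨hq1, hq2⟩ := max_lt_iff.1 hq
  have hδ' : 0 < 1 / δ := by positivity
  have hq0 : 1 < q := by linarith
  have hconj := (Real.HolderConjugate.conjExponent hq0).symm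
  set r := q.conjExponent with hr
  have hr1 : r < 1 + δ := by
    rw [hr, Real.conjExponent, div_lt_iff₀ (by linarith)]
    have : 1 < δ * (q - 1) := by
      have h1 : 1 / δ < q - 1 := by linarith
      rwa [div_lt_iff₀' hδ] at h1
    linarith
  have hk' := hk r hconj.lt hr1
  have hkr := lintegral_rpow_enorm_lt_top_of_eLpNorm_lt_top
    (by simpa using hconj.pos) ENNReal.ofReal_ne_top hk'.2
  rw [ENNReal.toReal_ofReal hconj.nonneg] at hkr
  refine (ENNReal.lintegral_mul_le_Lp_mul_Lq _ hconj hk'.1.enorm (by fun_prop)).trans_lt ?_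
  refine ENNReal.mul_lt_top (ENNReal.rpow_lt_top_of_nonneg (by simpa using hconj.nonneg) hkr.ne)
    (ENNReal.rpow_lt_top_of_nonneg (by simpa using hconj.symm.nonneg) ?_)
  rw [← lt_top_iff_ne_top]
  convert lintegral_cosh_rpow_neg_lt_top (β := β) (c := c * q) hα
    (by rwa [div_lt_iff₀' hc] at hq2) using 3 with t
  rw [ENNReal.ofReal_rpow_of_nonneg (Real.rpow_nonneg (Real.cosh_pos t).le _)
    hconj.symm.nonneg, ← Real.rpow_mul (Real.cosh_pos t).le, neg_mul]

/-- A Schur test for trilinear kernels. -/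
theorem lintegral_rpow_lintegral_le_of_schur {X : Type*} [MeasurableSpace X] {μ : Measure X}
    [SFinite μ] {p q : ℝ} (hpq : p.HolderConjugate q) {k f h : X → ℝ≥0∞} {N : X × X × X → ℝ≥0∞}
    (hk : AEMeasurable k μ) (hf : AEMeasurable f μ) (hh : Measurable h) (hN : Measurable N)
    (h0 : ∀ x, h x ≠ 0) (htop : ∀ x, h x ≠ ∞) {C M : ℝ≥0∞}
    (hC₁ : ∀ᵐ x ∂μ, ∀ᵐ y ∂μ, ∫⁻ z, N (x, y, z) * h z ^ q ∂μ ≤ C * (h x ^ q * h y ^ q))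
    (hC₂ : ∀ᵐ w ∂(μ.prod μ), ∫⁻ x, N (x, w) * h x ^ p ∂μ ≤ C * (h w.1 ^ p * h w.2 ^ p))
    (hM₁ : ∫⁻ y, k y * h y ^ q ∂μ ≤ M) (hM₂ : ∫⁻ y, k y * h y ^ p ∂μ ≤ M) :
    ∫⁻ x, (∫⁻ w, k w.1 * f w.2 * N (x, w) ∂(μ.prod μ)) ^ p ∂μ ≤
      (C * M) ^ p * ∫⁻ z, f z ^ p ∂μ := by
  have hp0 := hpq.pos
  have hq0 := hpq.symm.pos
  have hk1 : AEMeasurable (fun w : X × X => k w.1) (μ.prod μ) := hk.comp_fst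
  have hf2 : AEMeasurable (fun w : X × X => f w.2) (μ.prod μ) := hf.comp_snd
  have hNx (x : X) : Measurable fun w => N (x, w) := hN.comp measurable_prodMk_left
  have hkN (x : X) : AEMeasurable (fun w : X × X => k w.1 * N (x, w)) (μ.prod μ) :=
    hk1.mul (hNx x).aemeasurable
  have hA : ∀ᵐ x ∂μ, ∫⁻ w, k w.1 * N (x, w) * h w.2 ^ q ∂(μ.prod μ) ≤ C * M * h x ^ q := by
    filter_upwards [hC₁] with x hx
    rw [lintegral_prod _ (by fun_prop)]
    calc ∫⁻ y, ∫⁻ z, k y * N (x, y, z) * h z ^ q ∂μ ∂μ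
        ≤ ∫⁻ y, C * h x ^ q * (k y * h y ^ q) ∂μ := by
          refine lintegral_mono_ae ?_
          filter_upwards [hx] with y hy
          simp only [mul_assoc (k y)]
          rw [lintegral_const_mul _ (by fun_prop)]
          refine (mul_le_mul_right hy _).trans_eq ?_
          ring
      _ = C * h x ^ q * ∫⁻ y, k y * h y ^ q ∂μ := lintegral_const_mul'' _ (by fun_prop)
      _ ≤ C * h x ^ q * M := by gcongr
      _ = _ := by ring
  have hpoint : ∀ᵐ x ∂μ, (∫⁻ w, k w.1 * f w.2 * N (x, w) ∂(μ.prod μ)) ^ p ≤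
      (C * M) ^ (p / q) * ∫⁻ w, k w.1 * (f w.2 / h w.2) ^ p * (N (x, w) * h x ^ p)
        ∂(μ.prod μ) := by
    filter_upwards [hA] with x hx
    have hsplit (w : X × X) : k w.1 * f w.2 * N (x, w) =
        ((k w.1 * N (x, w)) ^ (1 / q) * h w.2) *
          ((k w.1 * N (x, w)) ^ (1 / p) * (f w.2 / h w.2)) := by
      have h1 : (k w.1 * N (x, w)) ^ (1 / q) * (k w.1 * N (x, w)) ^ (1 / p) =
          k w.1 * N (x, w) := by
        rw [← ENNReal.rpow_add_of_nonneg _ _ (by positivity) (by positivity)]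
        have : 1 / q + 1 / p = 1 := by
          simpa [one_div] using hpq.symm.inv_add_inv_eq_one
        rw [this, ENNReal.rpow_one]
      rw [mul_mul_mul_comm, h1, ENNReal.mul_div_cancel (h0 _) (htop _)]
      ring
    simp_rw [hsplit]
    have hHol := ENNReal.lintegral_mul_le_Lp_mul_Lq (μ.prod μ) hpq.symm
      (f := fun w : X × X => (k w.1 * N (x, w)) ^ (1 / q) * h w.2)
      (g := fun w : X × X => (k w.1 * N (x, w)) ^ (1 / p) * (f w.2 / h w.2))
      (by fun_prop) (by fun_prop)
    simp only [Pi.mul_apply, ENNReal.mul_rpow_of_nonneg _ _ hq0.le,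
      ENNReal.mul_rpow_of_nonneg _ _ hp0.le, ← ENNReal.rpow_mul, one_div,
      inv_mul_cancel₀ hq0.ne', inv_mul_cancel₀ hp0.ne', ENNReal.rpow_one] at hHol
    simp only [one_div]
    calc _ ≤ ((∫⁻ w, k w.1 * N (x, w) * h w.2 ^ q ∂(μ.prod μ)) ^ q⁻¹ *
          (∫⁻ w, k w.1 * N (x, w) * (f w.2 / h w.2) ^ p ∂(μ.prod μ)) ^ p⁻¹) ^ p := by gcongr
      _ = (∫⁻ w, k w.1 * N (x, w) * h w.2 ^ q ∂(μ.prod μ)) ^ (p / q) *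
          ∫⁻ w, k w.1 * N (x, w) * (f w.2 / h w.2) ^ p ∂(μ.prod μ) := by
        rw [ENNReal.mul_rpow_of_nonneg _ _ hp0.le, ← ENNReal.rpow_mul, ← ENNReal.rpow_mul,
          inv_mul_cancel₀ hp0.ne', ENNReal.rpow_one, inv_mul_eq_div]
      _ ≤ (C * M * h x ^ q) ^ (p / q) *
          ∫⁻ w, k w.1 * N (x, w) * (f w.2 / h w.2) ^ p ∂(μ.prod μ) := by gcongr
      _ = _ := by
        rw [ENNReal.mul_rpow_of_nonneg _ _ (by positivity), ← ENNReal.rpow_mul,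
          mul_div_cancel₀ _ hq0.ne', mul_assoc, ← lintegral_const_mul'' _ (by fun_prop)]
        congr 2 with w
        ring
  have hg : AEMeasurable (fun w : X × X => k w.1 * (f w.2 / h w.2) ^ p) (μ.prod μ) := by
    fun_prop
  have hjoint : AEMeasurable (fun v : X × X × X =>
      k v.2.1 * (f v.2.2 / h v.2.2) ^ p * (N v * h v.1 ^ p)) (μ.prod (μ.prod μ)) :=
    (hg.comp_snd).mul (by fun_prop)
  calc _ ≤ ∫⁻ x, (C * M) ^ (p / q) * ∫⁻ w, k w.1 * (f w.2 / h w.2) ^ p *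
          (N (x, w) * h x ^ p) ∂(μ.prod μ) ∂μ := lintegral_mono_ae hpoint
    _ = (C * M) ^ (p / q) * ∫⁻ x, ∫⁻ w, k w.1 * (f w.2 / h w.2) ^ p *
          (N (x, w) * h x ^ p) ∂(μ.prod μ) ∂μ := by
        refine lintegral_const_mul'' _ hjoint.lintegral_prod_right'
    _ = (C * M) ^ (p / q) * ∫⁻ w, ∫⁻ x, k w.1 * (f w.2 / h w.2) ^ p *
          (N (x, w) * h x ^ p) ∂μ ∂(μ.prod μ) := by
        rw [lintegral_lintegral_swap hjoint]
    _ ≤ (C * M) ^ (p / q) * ∫⁻ w, C * ((k w.1 * h w.1 ^ p) * f w.2 ^ p) ∂(μ.prod μ) := by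
        refine mul_le_mul_right (lintegral_mono_ae ?_) _
        filter_upwards [hC₂] with w hw
        rw [lintegral_const_mul _ (by fun_prop)]
        refine (mul_le_mul_right hw _).trans_eq ?_
        have h1 : (f w.2 / h w.2) ^ p * h w.2 ^ p = f w.2 ^ p := by
          rw [← ENNReal.mul_rpow_of_nonneg _ _ hp0.le, ENNReal.div_mul_cancel (h0 _) (htop _)]
        rw [← h1]
        ring
    _ = (C * M) ^ (p / q) * (C * ((∫⁻ y, k y * h y ^ p ∂μ) * ∫⁻ z, f z ^ p ∂μ)) := by
        rw [lintegral_const_mul'' _ (by fun_prop), lintegral_prod_mul (f := fun y => k y * h y ^ p)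
          (g := fun z => f z ^ p) (by fun_prop) (by fun_prop)]
    _ ≤ (C * M) ^ (p / q) * (C * (M * ∫⁻ z, f z ^ p ∂μ)) := by gcongr
    _ = _ := by
        have : p = p / q + 1 := by
          rw [hpq.div_conj_eq_sub_one]
          ring
        conv_rhs => rw [this, ENNReal.rpow_add_of_nonneg _ _ (by positivity) zero_le_one,
          ENNReal.rpow_one, ← this]
        ring

theorem measurable_jacobiKernel_right {α β : ℝ} (hα : 1 / 2 < α) (hαβ : β < α)
    (hβ : -1 / 2 < β) (x : ℝ) :
    Measurable fun w : ℝ × ℝ => jacobiKernel α β x w.1 w.2 :=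
  (measurable_jacobiKernel (by linarith) (by linarith) (by linarith)).comp measurable_prodMk_left

/-- The maximal form of the Kunze--Stein estimate: the convolution with `‖k‖` is bounded on
`L^p`. -/
theorem exists_lintegral_rpow_lintegral_jacobiKernel_le {α β δ : ℝ} (hα : 1 / 2 < α)
    (hαβ : β < α) (hβ : -1 / 2 < β) (hδ : 0 < δ) {k : ℝ → ℂ}
    (hkm : AEStronglyMeasurable k (jacobiMeasure α β))
    (hk : ∀ r : ℝ, 1 < r → r < 1 + δ → MemLp k (ENNReal.ofReal r) (jacobiMeasure α β))
    {p : ℝ} (hp : 1 < p) :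
    ∃ C : ℝ≥0∞, C ≠ ∞ ∧ ∀ f : ℝ → ℂ, AEStronglyMeasurable f (jacobiMeasure α β) →
      ∫⁻ x, (∫⁻ w, ‖k w.1 * f w.2 * (jacobiKernel α β x w.1 w.2 : ℂ)‖ₑ
        ∂((jacobiMeasure α β).prod (jacobiMeasure α β))) ^ p ∂(jacobiMeasure α β) ≤
      C ^ p * ∫⁻ z, ‖f z‖ₑ ^ p ∂(jacobiMeasure α β) := by
  obtain ⟨C, hC, hCK⟩ := exists_lintegral_jacobiKernel_le hα hαβ hβ
  have hpq := Real.HolderConjugate.conjExponent hp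
  set q := p.conjExponent
  have hp0 := hpq.pos
  have hq0 := hpq.symm.pos
  have hβ' : 0 < β + 1 / 2 := by linarith
  set γ : ℝ := (β + 1 / 2) / (p + q) with hγ
  have hγ0 : 0 < γ := by positivity
  have hγs : γ * (p + q) = β + 1 / 2 := div_mul_cancel₀ _ (by positivity)
  have hpow (x e : ℝ) (he : 0 ≤ e) : ENNReal.ofReal (Real.cosh x ^ (-γ)) ^ e =
      ENNReal.ofReal (Real.cosh x ^ (-(γ * e))) := by
    rw [ENNReal.ofReal_rpow_of_nonneg (Real.rpow_nonneg (Real.cosh_pos x).le _) he,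
      ← Real.rpow_mul (Real.cosh_pos x).le, neg_mul]
  have hM (e : ℝ) (he : 0 < e) :=
    lintegral_enorm_mul_cosh_rpow_neg_lt_top (β := β) (by linarith) hδ hk (mul_pos hγ0 he)
  set M := max (∫⁻ t, ‖k t‖ₑ * ENNReal.ofReal (Real.cosh t ^ (-(γ * q))) ∂(jacobiMeasure α β))
    (∫⁻ t, ‖k t‖ₑ * ENNReal.ofReal (Real.cosh t ^ (-(γ * p))) ∂(jacobiMeasure α β)) with hMdef
  refine ⟨C * M, ENNReal.mul_ne_top hC (max_lt (hM q hq0) (hM p hp0)).ne, fun f hf => ?_⟩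
  have hpos := ae_jacobiMeasure_pos α β
  have hNm := (measurable_jacobiKernel (α := α) (β := β) (by linarith) (by linarith)
    (by linarith)).enorm
  have hKc (r : ℝ) : ‖(r : ℂ)‖ₑ = ‖r‖ₑ := by
    rw [← ofReal_norm, ← ofReal_norm, Complex.norm_real]
  simp only [enorm_mul, hKc]
  refine lintegral_rpow_lintegral_le_of_schur (μ := jacobiMeasure α β) hpq
    (h := fun x => ENNReal.ofReal (Real.cosh x ^ (-γ)))
    (N := fun v => ‖jacobiKernel α β v.1 v.2.1 v.2.2‖ₑ) hkm.enorm hf.enorm (by fun_prop) hNm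
    (fun x => ?_) (fun x => ENNReal.ofReal_ne_top) ?_ ?_ ?_ ?_
  · exact (ENNReal.ofReal_pos.2 (Real.rpow_pos_of_pos (Real.cosh_pos x) _)).ne'
  · filter_upwards [hpos] with x hx
    filter_upwards [hpos] with y hy
    simp only [hpow _ _ hq0.le]
    exact hCK (γ * q) (by positivity) (by nlinarith) x y hx hy
  · filter_upwards [Measure.quasiMeasurePreserving_fst.ae hpos,
      Measure.quasiMeasurePreserving_snd.ae hpos] with w hy hz
    simp only [hpow _ _ hp0.le]
    refine (hCK (γ * p) (by positivity) (by nlinarith) w.1 w.2 hy hz).trans' (le_of_eq ?_)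
    congr 1 with x
    rw [← jacobiKernel_swap_left, ← jacobiKernel_swap_right]
  · simp only [hpow _ _ hq0.le]
    exact le_max_left _ _
  · simp only [hpow _ _ hp0.le]
    exact le_max_right _ _

theorem aestronglyMeasurable_jacobiConvolution_integrand {α β : ℝ} (hα : 1 / 2 < α)
    (hαβ : β < α) (hβ : -1 / 2 < β) {k f : ℝ → ℂ}
    (hk : AEStronglyMeasurable k (jacobiMeasure α β))
    (hf : AEStronglyMeasurable f (jacobiMeasure α β)) :
    AEStronglyMeasurable (fun v : ℝ × ℝ × ℝ =>
      k v.2.1 * f v.2.2 * (jacobiKernel α β v.1 v.2.1 v.2.2 : ℂ))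
      ((jacobiMeasure α β).prod ((jacobiMeasure α β).prod (jacobiMeasure α β))) := by
  have h : AEStronglyMeasurable (fun w : ℝ × ℝ => k w.1 * f w.2)
      ((jacobiMeasure α β).prod (jacobiMeasure α β)) := hk.comp_fst.mul hf.comp_snd
  exact h.comp_snd.mul (Complex.measurable_ofReal.comp (measurable_jacobiKernel (by linarith)
    (by linarith) (by linarith))).aestronglyMeasurable

theorem aestronglyMeasurable_jacobiConvolution_section {α β : ℝ} (hα : 1 / 2 < α)
    (hαβ : β < α) (hβ : -1 / 2 < β) {k f : ℝ → ℂ}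
    (hk : AEStronglyMeasurable k (jacobiMeasure α β))
    (hf : AEStronglyMeasurable f (jacobiMeasure α β)) (x : ℝ) :
    AEStronglyMeasurable (fun w : ℝ × ℝ => k w.1 * f w.2 * (jacobiKernel α β x w.1 w.2 : ℂ))
      ((jacobiMeasure α β).prod (jacobiMeasure α β)) :=
  (hk.comp_fst.mul hf.comp_snd).mul (Complex.measurable_ofReal.comp
    (measurable_jacobiKernel_right hα hαβ hβ x)).aestronglyMeasurable

theorem JacobiConvolutionExistsAt.jacobiConvolution_eq {α β : ℝ} {k f : ℝ → ℂ} {x : ℝ}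
    (h : JacobiConvolutionExistsAt α β k f x) :
    jacobiConvolution α β k f x =
      ∫ w, k w.1 * f w.2 * (jacobiKernel α β x w.1 w.2 : ℂ)
        ∂((jacobiMeasure α β).prod (jacobiMeasure α β)) := by
  rw [integral_prod _ h]
  simp only [jacobiConvolution, jacobiTranslation, mul_assoc, integral_const_mul]

theorem jacobiConvolution_congr_right {α β : ℝ} (k : ℝ → ℂ) {f g : ℝ → ℂ}
    (h : f =ᵐ[jacobiMeasure α β] g) :
    jacobiConvolution α β k f = jacobiConvolution α β k g := by
  ext x
  have (y : ℝ) : jacobiTranslation α β x f y = jacobiTranslation α β x g y :=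
    integral_congr_ae (h.mono fun z hz => by simp only [hz])
  simp only [jacobiConvolution, this]

theorem jacobiConvolution_const_smul (α β : ℝ) (k f : ℝ → ℂ) (c : ℂ) :
    jacobiConvolution α β k (c • f) = c • jacobiConvolution α β k f := by
  ext x
  simp only [jacobiConvolution, jacobiTranslation, Pi.smul_apply, smul_eq_mul, mul_assoc,
    integral_const_mul, mul_left_comm _ c]

theorem jacobiConvolution_add {α β : ℝ} {k f g : ℝ → ℂ} {x : ℝ}
    (hf : JacobiConvolutionExistsAt α β k f x) (hg : JacobiConvolutionExistsAt α β k g x) :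
    jacobiConvolution α β k (f + g) x =
      jacobiConvolution α β k f x + jacobiConvolution α β k g x := by
  have h : (fun w : ℝ × ℝ => k w.1 * (f + g) w.2 * (jacobiKernel α β x w.1 w.2 : ℂ)) =
      fun w => k w.1 * f w.2 * (jacobiKernel α β x w.1 w.2 : ℂ) +
        k w.1 * g w.2 * (jacobiKernel α β x w.1 w.2 : ℂ) := by
    ext w
    simp only [Pi.add_apply]
    ring
  have hfg : JacobiConvolutionExistsAt α β k (f + g) x := by
    unfold JacobiConvolutionExistsAt
    rw [h]
    exact hf.add hg
  rw [hf.jacobiConvolution_eq, hg.jacobiConvolution_eq, hfg.jacobiConvolution_eq, h,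
    integral_add hf hg]

theorem aestronglyMeasurable_jacobiConvolution {α β : ℝ} (hα : 1 / 2 < α)
    (hαβ : β < α) (hβ : -1 / 2 < β) {k f : ℝ → ℂ}
    (hk : AEStronglyMeasurable k (jacobiMeasure α β))
    (hf : AEStronglyMeasurable f (jacobiMeasure α β))
    (h : ∀ᵐ x ∂(jacobiMeasure α β), JacobiConvolutionExistsAt α β k f x) :
    AEStronglyMeasurable (jacobiConvolution α β k f) (jacobiMeasure α β) :=
  (aestronglyMeasurable_jacobiConvolution_integrand hα hαβ hβ hk hf).integral_prod_right'.congr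
    (h.mono fun _ hx => hx.jacobiConvolution_eq.symm)

theorem mainTheorem10 (α β : ℝ) (hα : 1 / 2 < α) (hαβ : β < α) (hβ : -1 / 2 < β)
    (δ : ℝ) (hδ : 0 < δ) (k : ℝ → ℂ) (hk_even : Function.Even k)
    (hk : ∀ r : ℝ, 1 < r → r < 1 + δ → MemLp k (ENNReal.ofReal r) (jacobiMeasure α β))
    (s : ℝ≥0∞) [Fact (1 ≤ s)] (hs₁ : 1 < s) (hs₂ : s < ∞) :
    ∃ T : Lp ℂ s (jacobiMeasure α β) →L[ℂ] Lp ℂ s (jacobiMeasure α β),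
      ∀ f : Lp ℂ s (jacobiMeasure α β),
        (∀ᵐ x ∂(jacobiMeasure α β), JacobiConvolutionExistsAt α β k f x) ∧
        T f =ᵐ[jacobiMeasure α β] jacobiConvolution α β k f := by
  have hkm : AEStronglyMeasurable k (jacobiMeasure α β) :=
    (hk (1 + δ / 2) (by linarith) (by linarith)).1
  have hs0 : s ≠ 0 := (one_pos.trans hs₁).ne'
  have hp : 1 < s.toReal := by
    rw [← ENNReal.toReal_one]
    exact (ENNReal.toReal_lt_toReal ENNReal.one_ne_top hs₂.ne).2 hs₁
  have hp0 : 0 < s.toReal := one_pos.trans hp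
  obtain ⟨C, hC, hbound⟩ :=
    exists_lintegral_rpow_lintegral_jacobiKernel_le hα hαβ hβ hδ hkm hk hp
  have hfin (f : Lp ℂ s (jacobiMeasure α β)) :
      C ^ s.toReal * ∫⁻ z, ‖f z‖ₑ ^ s.toReal ∂(jacobiMeasure α β) < ∞ :=
    ENNReal.mul_lt_top (ENNReal.rpow_lt_top_of_nonneg hp0.le hC)
      (lintegral_rpow_enorm_lt_top_of_eLpNorm_lt_top hs0 hs₂.ne (Lp.memLp f).2)
  have hex (f : Lp ℂ s (jacobiMeasure α β)) :
      ∀ᵐ x ∂(jacobiMeasure α β), JacobiConvolutionExistsAt α β k f x := by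
    have hfm := (Lp.memLp f).1
    have hm := ((aestronglyMeasurable_jacobiConvolution_integrand hα hαβ hβ hkm
      hfm).enorm.lintegral_prod_right').pow_const s.toReal
    filter_upwards [ae_lt_top' hm ((hbound f hfm).trans_lt (hfin f)).ne] with x hx
    refine ⟨aestronglyMeasurable_jacobiConvolution_section hα hαβ hβ hkm hfm x, ?_⟩
    exact (ENNReal.rpow_lt_top_iff_of_pos hp0).1 hx
  have hnorm (f : Lp ℂ s (jacobiMeasure α β)) :
      eLpNorm (jacobiConvolution α β k f) s (jacobiMeasure α β) ≤
        C * eLpNorm f s (jacobiMeasure α β) := by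
    rw [eLpNorm_eq_lintegral_rpow_enorm_toReal hs0 hs₂.ne,
      eLpNorm_eq_lintegral_rpow_enorm_toReal hs0 hs₂.ne]
    calc _ ≤ (C ^ s.toReal * ∫⁻ z, ‖f z‖ₑ ^ s.toReal ∂(jacobiMeasure α β)) ^ (1 / s.toReal) := by
          gcongr
          refine (lintegral_mono_ae ?_).trans (hbound f (Lp.memLp f).1)
          filter_upwards [hex f] with x hx
          rw [hx.jacobiConvolution_eq]
          gcongr
          exact enorm_integral_le_lintegral_enorm _
      _ = _ := by
          rw [ENNReal.mul_rpow_of_nonneg _ _ (by positivity), ← ENNReal.rpow_mul,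
            mul_one_div_cancel hp0.ne', ENNReal.rpow_one]
  have hmem (f : Lp ℂ s (jacobiMeasure α β)) :
      MemLp (jacobiConvolution α β k f) s (jacobiMeasure α β) :=
    ⟨aestronglyMeasurable_jacobiConvolution hα hαβ hβ hkm (Lp.memLp f).1 (hex f),
      (hnorm f).trans_lt (ENNReal.mul_lt_top hC.lt_top (Lp.memLp f).2)⟩
  let T : Lp ℂ s (jacobiMeasure α β) →ₗ[ℂ] Lp ℂ s (jacobiMeasure α β) :=
    { toFun := fun f => (hmem f).toLp
      map_add' := fun f g => by
        rw [← MemLp.toLp_add, MemLp.toLp_eq_toLp_iff,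
          jacobiConvolution_congr_right k (Lp.coeFn_add f g)]
        filter_upwards [hex f, hex g] with x hf hg
        exact jacobiConvolution_add hf hg
      map_smul' := fun c f => by
        rw [RingHom.id_apply, ← MemLp.toLp_const_smul, MemLp.toLp_eq_toLp_iff,
          jacobiConvolution_congr_right k (Lp.coeFn_smul c f), jacobiConvolution_const_smul] }
  refine ⟨T.mkContinuous C.toReal fun f => ?_, fun f => ⟨hex f, (hmem f).coeFn_toLp⟩⟩
  change ‖(hmem f).toLp‖ ≤ _
  rw [Lp.norm_toLp, Lp.norm_def, ← ENNReal.toReal_mul]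
  exact ENNReal.toReal_mono (ENNReal.mul_ne_top hC (Lp.memLp f).2.ne) (hnorm f)
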